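/- Let $0<k<n$ be integers and let $p$ be a prime. Consider the oriented graph $\Gamma$ whose vertices are the boxes $(a,b)$, $1\le a\le k$, $1\le b\le n-k$, of a $k\times(n-k)$ rectangle together with two extra vertices $z_1,z_2$. Any two boxes sharing a side are joined by one edge, oriented from the box with larger $a+b$ to the box with smaller $a+b$; in addition there is one edge from the box $(1,1)$ to $z_1$ and one edge from $z_2$ to the box $(k,n-k)$. Attach a variable $x_c$ to each box $c$, put $x_{z_1}=z_1$, $x_{z_2}=z_2$, and let $$S(x,z)=\sum_{e\in\mathrm{edges}(\Gamma)}\frac{x_{h(e)}}{x_{t(e)}},$$ where $h(e)$ and $t(e)$ are the head and the tail of $e$. For $d\ge 0$ let $[S(x,z)^d]_0$ be the constant term of $S(x,z)^d$ as a Laurent polynomial in the box variables $x$. Then each $[S(x,z)^d]_0$ is a polynomial with integer coefficients in $z=z_1/z_2$, and for every $m$ only finitely many of these polynomials contain $z^m$ with a nonzero coefficient, so that $$\mathsf F(z)=\sum_{d=0}^{\infty}[S(x,z)^d]_0\in\mathbb Z[[z]],\qquad \mathsf F_s(z)=\sum_{d=0}^{p^s-1}[S(x,z)^d]_0\in\mathbb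 Z[z]\quad(s=0,1,2,\dots)$$ are well defined; they all have constant term $1$, so the quotients below exist in $\mathbb Z[[z]]$. For every $s\ge 1$ the following congruences hold coefficientwise in $\mathbb Z[[z]]$: $$\frac{\mathsf F(z)}{\mathsf F(z^p)}\equiv\frac{\mathsf F_s(z)}{\mathsf F_{s-1}(z^p)}\mod p^s, \qquad \frac{\mathsf F_{s+1}(z)}{\mathsf F_s(z^p)}\equiv\frac{\mathsf F_s(z)}{\mathsf F_{s-1}(z^p)}\mod p^s .$$ -/

import Mathlib

open scoped Polynomial PowerSeries

noncomputable section

namespace GrassmannSuperpotential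

/-- Boxes of the `k × (n - k)` rectangle. With 0-based coordinates `(a, b)`, and when `2 * k ≤ n`,
the box `(a, b)` lies in the vertical column `i = k + b - a` of the rotated rectangle and is the
`j`-th box of that column from below, where `j = min a b + 1`; its variable is `x_{i,j}`. -/
abbrev Box (k n : ℕ) : Type := Fin k × Fin (n - k)

/-- The weight of a box. In the column coordinates `(i, j)` it is `|i - k| + 2 * j - 1`.
It runs from `1` to `n - 1`. -/
def weight {k n : ℕ} (c : Box k n) : ℕ := c.1 + c.2 + 1

/-- Two boxes are adjacent when they have a side in common. -/
def BoxAdj {k n : ℕ} (c c' : Box k n) : Prop :=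
  (c.1 = c'.1 ∧ ((c.2 : ℕ) + 1 = c'.2 ∨ (c'.2 : ℕ) + 1 = c.2)) ∨
  (c.2 = c'.2 ∧ ((c.1 : ℕ) + 1 = c'.1 ∨ (c'.1 : ℕ) + 1 = c.1))

/-- The vertices of the graph `Γ`: the boxes and two extra vertices. -/
inductive Vertex (k n : ℕ) : Type
  | box (c : Box k n)
  | z₁
  | z₂
  deriving DecidableEq, Fintype

/-- `Edge t h`: there is an edge of `Γ` with tail `t` and head `h`. Adjacent boxes are joined by an
edge directed towards the smaller weight; there is an edge from the box of least weight to `z₁` and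
an edge from `z₂` to the box of greatest weight. -/
inductive Edge {k n : ℕ} : Vertex k n → Vertex k n → Prop
  | boxes (c c' : Box k n) (hadj : BoxAdj c c') (hw : weight c' < weight c) :
      Edge (.box c) (.box c')
  | bottom (c : Box k n) (h₁ : (c.1 : ℕ) = 0) (h₂ : (c.2 : ℕ) = 0) : Edge (.box c) .z₁
  | top (c : Box k n) (h₁ : (c.1 : ℕ) + 1 = k) (h₂ : (c.2 : ℕ) + 1 = n - k) : Edge .z₂ (.box c)

/-- Laurent polynomials over `ℤ` in `z₁, z₂`; the exponent `(a, b)` stands for `z₁ ^ a * z₂ ^ b`. -/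
abbrev ZLaurent : Type := AddMonoidAlgebra ℤ (ℤ × ℤ)

/-- Laurent polynomials in the variables `x`, one for each box, over `ℤ[z₁^±¹, z₂^±¹]`. -/
abbrev XLaurent (k n : ℕ) : Type := AddMonoidAlgebra ZLaurent (Box k n → ℤ)

/-- The Laurent monomial `x_v ^ e`, where `x_v` is the variable attached to the vertex `v`
(for the two extra vertices, this is `z₁`, respectively `z₂`). -/
def varPow {k n : ℕ} (v : Vertex k n) (e : ℤ) : XLaurent k n :=
  match v with
  | .box c => AddMonoidAlgebra.single (Pi.single c e) 1
  | .z₁ => AddMonoidAlgebra.single 0 (AddMonoidAlgebra.single (e, 0) 1)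
  | .z₂ => AddMonoidAlgebra.single 0 (AddMonoidAlgebra.single (0, e) 1)

open Classical in
/-- The superpotential `S(x, z) = ∑ x_{h(e)} / x_{t(e)}`, summed over the edges `e` of `Γ`. -/
def superpotential (k n : ℕ) : XLaurent k n :=
  ∑ e : Vertex k n × Vertex k n with Edge e.1 e.2, varPow e.2 1 * varPow e.1 (-1)

/-- The constant term `[f]₀` with respect to the variables `x`. -/
def constTerm {k n : ℕ} (f : XLaurent k n) : ZLaurent := f.coeff 0

/-- The element `z = z₁ / z₂`. -/
def zRatio : ZLaurent := AddMonoidAlgebra.single (1, -1) 1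

/-- The part of a Laurent polynomial in `z₁, z₂` supported on the monomials `z ^ m = (z₁ / z₂) ^ m`,
`m = 0, 1, 2, …`, as a polynomial in `z`. -/
def readZ (f : ZLaurent) : ℤ[X] :=
  .ofFinsupp (f.comapDomain (fun m : ℕ => ((m : ℤ), -(m : ℤ)))
    (fun a b h => by simpa using congrArg Prod.fst h))

/-- `[S(x, z) ^ d]₀` as a polynomial in `z`. -/
def ctS (k n d : ℕ) : ℤ[X] := readZ (constTerm (superpotential k n ^ d))

/-- The power series `F(z) = ∑_{d ≥ 0} [S(x, z) ^ d]₀`, summed coefficient by coefficient. -/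
def seriesF (k n : ℕ) : ℤ⟦X⟧ := .mk fun m => ∑ᶠ d : ℕ, (ctS k n d).coeff m

/-- The truncation `F_s(z) = ∑_{d < p ^ s} [S(x, z) ^ d]₀`. -/
def truncF (k n p s : ℕ) : ℤ[X] := ∑ d ∈ Finset.range (p ^ s), ctS k n d

/-- `f / g` in `ℤ⟦z⟧`, for `g` with constant term `1`. -/
def quot (f g : ℤ⟦X⟧) : ℤ⟦X⟧ := f * PowerSeries.invOfUnit g 1

/-- `f ≡ g mod N` for power series with integer coefficients. -/
def CongMod (N : ℤ) (f g : ℤ⟦X⟧) : Prop :=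
  ∀ m : ℕ, PowerSeries.coeff m f ≡ PowerSeries.coeff m g [ZMOD N]

end GrassmannSuperpotential

end

/-! ### Skew inverses and Dwork congruences in a commutative ring with an endomorphism. -/

namespace GhostCongruence

variable {R : Type*} [CommRing R]

/-! Let σ raise every variable to its p-th power and let P_s = ∑_{d < p^s} S^d. Base-p digits give
P_s = A_0 ⋯ A_{s-1} with A_i = ∑_{j < p} S^{j p^i}, and S^p ≡ σ(S) mod p implies A_{i+1} ≡ σ(A_i)
mod p^{i+1}. Let M_t be the coefficients of the inverse of ∑ P_t T^t among skew power series with T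
a = σ(a) T. The congruences for A force p^t ∣ M_{t+1} (`pow_dvd_skewInv_prod`).

The box exponents of M_t are less than p^t in absolute value, so the constant term of M_u σ^u(P_v)
is the product of the constant terms (`constTerm_mul_frobX_pow`). Hence the [M_t]_0 form the skew
inverse of the truncations F_t = [P_t]_0, with the same divisibility, and `dwork_congruence` yields
F_{a+1} σ(F_b) ≡ F_{b+1} σ(F_a) mod p^{b+1} for b ≤ a. Taking b = s - 1, the case a = s is the
second congruence and a → ∞ is the first. Two gradings show that [S^d]_0 is a multiple of z^{d/n},
and zero if n ∤ d, so everything descends to ℤ[z]. -/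

theorem natCast_pow_dvd_map {S : Type*} [CommRing S] (τ : R →+* S) {p k : ℕ} {x : R}
    (h : (p : R) ^ k ∣ x) : (p : S) ^ k ∣ τ x := by
  simpa using map_dvd τ h

/-- The coefficients of the inverse of `∑ P t * T ^ t` in the ring of skew power series over `R`
with `T * a = σ a * T`, when `P 0 = 1`. -/
noncomputable def skewInv (σ : R →+* R) (P : ℕ → R) : ℕ → R
  | 0 => 1
  | t + 1 => -∑ u : Fin (t + 1), skewInv σ P u * (σ ^ (u : ℕ)) (P (t + 1 - u))

theorem skewInv_zero (σ : R →+* R) (P : ℕ → R) : skewInv σ P 0 = 1 := by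
  rw [skewInv]

theorem skewInv_succ (σ : R →+* R) (P : ℕ → R) (t : ℕ) :
    skewInv σ P (t + 1) =
      -∑ u ∈ Finset.range (t + 1), skewInv σ P u * (σ ^ u) (P (t + 1 - u)) := by
  rw [skewInv, Finset.sum_range]

theorem sum_skewInv_mul (σ : R →+* R) {P : ℕ → R} (hP : P 0 = 1) (t : ℕ) :
    ∑ u ∈ Finset.range (t + 2), skewInv σ P u * (σ ^ u) (P (t + 1 - u)) = 0 := by
  rw [Finset.sum_range_succ, skewInv_succ]
  simp [hP]

/-- If `A (i + 1) ≡ σ (A i)` modulo `p ^ (i + 1)`, then the partial sums of the convolution of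
the skew inverse of the products `∏ i < t, A i` with these products are divisible by powers
of `p`. -/
theorem pow_dvd_sum_skewInv_mul (σ : R →+* R) (p : ℕ) (A : ℕ → R)
    (hA : ∀ i, (p : R) ^ (i + 1) ∣ A (i + 1) - σ (A i)) (i : ℕ) :
    ∀ u ≤ i, (p : R) ^ u ∣ ∑ t ∈ Finset.range (u + 1),
      skewInv σ (fun s => ∏ j ∈ Finset.range s, A j) t *
        (σ ^ t) (∏ j ∈ Finset.range (i - t), A j) := by
  set P : ℕ → R := fun s => ∏ j ∈ Finset.range s, A j with hP
  set M := skewInv σ P with hM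
  have hPs (s : ℕ) : P (s + 1) = P s * A s := Finset.prod_range_succ A s
  change ∀ u ≤ i, (p : R) ^ u ∣ ∑ t ∈ Finset.range (u + 1), M t * (σ ^ t) (P (i - t))
  induction i with
  | zero => intro u hu; simp [Nat.le_zero.mp hu]
  | succ i ih =>
    -- Abel summation: the new factors `(σ ^ t) (A (i - t))` can all be replaced by the last one.
    -- Moving from `t` to `t + 1` changes the factor by a multiple of p^(i-t), and it multiplies the
    -- partial sum up to `t`, which is divisible by p^t.
    have key : ∀ u ≤ i, (p : R) ^ i ∣
        ∑ t ∈ Finset.range (u + 1), M t * (σ ^ t) (P (i + 1 - t)) -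
          (∑ t ∈ Finset.range (u + 1), M t * (σ ^ t) (P (i - t))) * (σ ^ u) (A (i - u)) := by
      intro u
      induction u with
      | zero => intro _; simp [hPs, mul_assoc]
      | succ u ihu =>
        intro hu
        obtain ⟨v, rfl⟩ : ∃ v, i = u + 1 + v := ⟨i - (u + 1), by omega⟩
        have h1 := ihu (by omega)
        have h2 : (p : R) ^ (v + 1) ∣ (σ ^ u) (A (v + 1) - σ (A v)) :=
          natCast_pow_dvd_map _ (hA v)
        have h3 := mul_dvd_mul (ih u (by omega)) h2
        rw [← pow_add, show u + (v + 1) = u + 1 + v by ring] at h3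
        have h4 := dvd_add h1 h3
        rw [Finset.sum_range_succ _ (u + 1), Finset.sum_range_succ _ (u + 1),
          show u + 1 + v + 1 - (u + 1) = v + 1 by omega, show u + 1 + v - (u + 1) = v by omega,
          hPs]
        rw [show u + 1 + v - u = v + 1 by omega] at h4
        convert h4 using 1
        simp only [map_mul, map_sub, pow_succ σ, RingHom.mul_def, RingHom.comp_apply]
        ring
    intro u hu
    rcases Nat.lt_or_ge i u with h | h
    · obtain rfl : u = i + 1 := by omega
      rw [sum_skewInv_mul σ (by simp [hP])]
      exact dvd_zero _
    · have h1 := dvd_trans (pow_dvd_pow (p : R) h) (key u h)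
      exact (dvd_iff_dvd_of_dvd_sub h1).mpr (Dvd.dvd.mul_right (ih u h) _)

/-- By the recursion, this coefficient is minus the convolution sum of index `t + 1` stopped one
term early. -/
theorem pow_dvd_skewInv_prod (σ : R →+* R) (p : ℕ) (A : ℕ → R)
    (hA : ∀ i, (p : R) ^ (i + 1) ∣ A (i + 1) - σ (A i)) (t : ℕ) :
    (p : R) ^ t ∣ skewInv σ (fun s => ∏ j ∈ Finset.range s, A j) (t + 1) := by
  rw [skewInv_succ, dvd_neg]
  exact (pow_dvd_sum_skewInv_mul σ p A hA (t + 1)) t t.le_succ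

/-- If the coefficients of the skew inverse of `∑ F t * T ^ t` are divisible by powers of `p`, then
`F` satisfies Dwork's congruences. -/
theorem dwork_congruence (σ : R →+* R) (p : ℕ) (F M : ℕ → R) (hM0 : M 0 = 1)
    (hM : ∀ t, (p : R) ^ t ∣ M (t + 1))
    (hF : ∀ t, ∑ u ∈ Finset.range (t + 2), M u * (σ ^ u) (F (t + 1 - u)) = 0)
    (m a b : ℕ) (hm : 0 < m) (hba : b ≤ a) :
    (p : R) ^ (b + 1) ∣ F (m + a) * (σ ^ m) (F b) - F (m + b) * (σ ^ m) (F a) := by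
  induction hN : m + a using Nat.strong_induction_on generalizing m a b with
  | _ N ih =>
  subst hN
  -- Extension by zero lets the expansions of `F (m + a)` and `F (m + b)` share one index range, so
  -- they can be compared term by term.
  let T (n r : ℕ) : R := if r ≤ n then (σ ^ r) (F (n - r)) else 0
  have hT (K n : ℕ) (h0 : 0 < n) (h : n ≤ K) :
      F n = -∑ r ∈ Finset.range K, M (r + 1) * T n (r + 1) := by
    obtain ⟨t, rfl⟩ : ∃ t, n = t + 1 := ⟨n - 1, by omega⟩
    obtain ⟨d, rfl⟩ := Nat.exists_eq_add_of_le h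
    rw [Finset.sum_range_add, Finset.sum_eq_zero (s := Finset.range d), add_zero,
      eq_neg_iff_add_eq_zero]
    · rw [← hF t, Finset.sum_range_succ' _ (t + 1), add_comm]
      congr 1
      · refine Finset.sum_congr rfl fun r hr => ?_
        simp only [T, if_pos (show r + 1 ≤ t + 1 by simpa using hr)]
      · simp [hM0]
    · intro r _
      simp [T, show ¬ (t + 1 + r + 1 ≤ t + 1) by omega]
  rw [hT (m + a) (m + a) (by omega) le_rfl, hT (m + a) (m + b) (by omega) (by omega),
    neg_mul, neg_mul, ← neg_sub', dvd_neg, Finset.sum_mul, Finset.sum_mul,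
    ← Finset.sum_sub_distrib]
  refine Finset.dvd_sum fun r hr => ?_
  rw [mul_assoc, mul_assoc, ← mul_sub]
  have hr : r + 1 ≤ m + a := by simpa using hr
  rcases lt_trichotomy (r + 1) m with h | h | h
  · obtain ⟨d, rfl⟩ := Nat.exists_eq_add_of_lt h
    have := ih _ (by omega) (d + 1) a b (by omega) hba rfl
    have h' := natCast_pow_dvd_map (σ ^ (r + 1)) this
    refine Dvd.dvd.mul_left ?_ _
    simp only [T]
    rw [if_pos (by omega), if_pos (by omega), show r + 1 + d + 1 + a - (r + 1) = d + 1 + a by omega,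
      show r + 1 + d + 1 + b - (r + 1) = d + 1 + b by omega,
      show r + 1 + d + 1 = (r + 1) + (d + 1) by omega, pow_add σ (r + 1)]
    simpa only [map_sub, map_mul, RingHom.mul_def, RingHom.comp_apply] using h'
  -- Here both products are `(σ ^ m) (F a * F b)`, so the difference vanishes.
  · subst h
    simp only [T]
    rw [if_pos (by omega), if_pos (by omega), Nat.add_sub_cancel_left, Nat.add_sub_cancel_left,
      mul_comm, sub_eq_zero_of_eq (mul_comm _ _)]
    simp
  -- Now `σ ^ m` factors out and leaves, up to sign, the congruence for shift `d + 1`. The powers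
  -- p^(m+d) from `M (r + 1)` and p^(b-d) from induction give p^(m+b), which suffices as `0 < m`.
  · obtain ⟨d, hd⟩ := Nat.exists_eq_add_of_lt h
    by_cases hrb : r + 1 ≤ m + b
    · have := ih _ (by omega) (d + 1) (a - (d + 1)) (b - (d + 1)) (by omega) (by omega) rfl
      have h' := mul_dvd_mul (hM r) (natCast_pow_dvd_map (σ ^ m) this)
      rw [← pow_add] at h'
      refine dvd_trans (pow_dvd_pow _ (by omega)) ((dvd_neg.mpr h').trans (dvd_of_eq ?_))
      simp only [T]
      rw [if_pos (by omega), if_pos (by omega), hd, show d + 1 + (a - (d + 1)) = a by omega,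
        show d + 1 + (b - (d + 1)) = b by omega, show m + a - (m + d + 1) = a - (d + 1) by omega,
        show m + b - (m + d + 1) = b - (d + 1) by omega, add_assoc, pow_add σ m]
      simp only [map_sub, map_mul, RingHom.mul_def, RingHom.comp_apply]
      ring
    -- Here `r ≥ m + b ≥ b + 1`, so the factor `M (r + 1)` is enough.
    · exact Dvd.dvd.mul_right (dvd_trans (pow_dvd_pow _ (by omega)) (hM r)) _

/-! ### Geometric sums and Frobenius lifts. -/

theorem geom_sum_mul_geom_sum (x : R) (m k : ℕ) :
    (∑ d ∈ Finset.range m, x ^ d) * ∑ j ∈ Finset.range k, (x ^ m) ^ j =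
      ∑ d ∈ Finset.range (m * k), x ^ d := by
  induction k with
  | zero => simp
  | succ k ih =>
    rw [Finset.sum_range_succ, mul_add, ih, Nat.mul_succ, Finset.sum_range_add, Finset.sum_mul]
    simp_rw [pow_add, pow_mul, mul_comm]

theorem prod_geom_sum (x : R) (p s : ℕ) :
    ∏ i ∈ Finset.range s, ∑ j ∈ Finset.range p, (x ^ p ^ i) ^ j =
      ∑ d ∈ Finset.range (p ^ s), x ^ d := by
  induction s with
  | zero => simp
  | succ s ih => rw [Finset.prod_range_succ, ih, geom_sum_mul_geom_sum, pow_succ]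

/-- Raising a congruence mod p to the power p^i makes it hold mod p^(i+1). -/
theorem pow_dvd_geom_sum_sub (σ : R →+* R) {p : ℕ} {x : R} (h : (p : R) ∣ x ^ p - σ x) (i : ℕ) :
    (p : R) ^ (i + 1) ∣ ∑ j ∈ Finset.range p, (x ^ p ^ (i + 1)) ^ j -
      σ (∑ j ∈ Finset.range p, (x ^ p ^ i) ^ j) := by
  rw [map_sum, ← Finset.sum_sub_distrib]
  refine Finset.dvd_sum fun j _ => ?_
  rw [map_pow, map_pow, pow_succ' p, pow_mul]
  exact (dvd_sub_pow_of_dvd_sub h i).trans (sub_dvd_pow_sub_pow _ _ j)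

theorem dvd_sum_pow_sub_map (σ : R →+* R) {p : ℕ} (hp : p.Prime) {ι : Type*} (s : Finset ι)
    (f : ι → R) (h : ∀ i ∈ s, σ (f i) = f i ^ p) :
    (p : R) ∣ (∑ i ∈ s, f i) ^ p - σ (∑ i ∈ s, f i) := by
  classical
  induction s using Finset.induction_on with
  | empty => simp [hp.ne_zero]
  | insert i s hi ih =>
    rw [Finset.sum_insert hi, map_add, h i (Finset.mem_insert_self i s)]
    obtain ⟨r, hr⟩ := exists_add_pow_prime_eq hp (f i) (∑ i ∈ s, f i)
    obtain ⟨q, hq⟩ := ih fun j hj => h j (Finset.mem_insert_of_mem hj)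
    exact ⟨q + f i * (∑ i ∈ s, f i) * r, by linear_combination hr + hq⟩

end GhostCongruence

/-! ### Laurent monomials, exponent bounds and constant terms. -/

namespace GrassmannSuperpotential

open GhostCongruence

/-- The Frobenius lift `z_i ↦ z_i ^ p`. -/
noncomputable def frobZ (p : ℕ) : ZLaurent →+* ZLaurent :=
  AddMonoidAlgebra.mapDomainRingHom ℤ (nsmulAddMonoidHom p)

/-- The Frobenius lift `x_c ↦ x_c ^ p`, `z_i ↦ z_i ^ p`. -/
noncomputable def frobX (k n p : ℕ) : XLaurent k n →+* XLaurent k n :=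
  (AddMonoidAlgebra.mapRingHom _ (frobZ p)).comp
    (AddMonoidAlgebra.mapDomainRingHom ZLaurent (nsmulAddMonoidHom p))

theorem frobZ_single (p : ℕ) (v : ℤ × ℤ) (r : ℤ) :
    frobZ p (AddMonoidAlgebra.single v r) = AddMonoidAlgebra.single (p • v) r := by
  simp [frobZ, AddMonoidAlgebra.mapDomainRingHom]

theorem frobX_single {k n : ℕ} (p : ℕ) (u : Box k n → ℤ) (r : ZLaurent) :
    frobX k n p (AddMonoidAlgebra.single u r) = AddMonoidAlgebra.single (p • u) (frobZ p r) := by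
  simp [frobX, AddMonoidAlgebra.mapDomainRingHom]

/-- Exponents of Laurent monomials in `x, z₁, z₂`. -/
abbrev Expo (k n : ℕ) : Type := (Box k n → ℤ) × (ℤ × ℤ)

/-- The Laurent monomial with a given exponent. -/
noncomputable def mono {k n : ℕ} (e : Expo k n) : XLaurent k n :=
  AddMonoidAlgebra.single e.1 (AddMonoidAlgebra.single e.2 1)

variable {k n : ℕ}

theorem mono_zero : mono (0 : Expo k n) = 1 := rfl

theorem mono_mul (e f : Expo k n) : mono e * mono f = mono (e + f) := by
  simp [mono, AddMonoidAlgebra.single_mul_single]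

theorem mono_pow (e : Expo k n) (m : ℕ) : mono e ^ m = mono (m • e) := by
  simp [mono, AddMonoidAlgebra.single_pow]

theorem frobX_mono (p : ℕ) (e : Expo k n) : frobX k n p (mono e) = mono (p • e) := by
  simp [mono, frobX_single, frobZ_single]

theorem frobX_pow_mono (p t : ℕ) (e : Expo k n) :
    (frobX k n p ^ t) (mono e) = mono (p ^ t • e) := by
  induction t with
  | zero => simp
  | succ t ih => rw [pow_succ', RingHom.mul_def, RingHom.comp_apply, ih, frobX_mono, smul_smul,
      pow_succ']

/-- The constant term with respect to `x`, as a linear map. -/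
noncomputable def constTermₗ (k n : ℕ) : XLaurent k n →ₗ[ℤ] ZLaurent :=
  AddMonoidHom.toIntLinearMap
    { toFun := constTerm, map_zero' := rfl, map_add' := fun _ _ => rfl }

theorem constTermₗ_apply (f : XLaurent k n) : constTermₗ k n f = constTerm f := rfl

theorem constTerm_mono (e : Expo k n) :
    constTerm (mono e) = if e.1 = 0 then AddMonoidAlgebra.single e.2 1 else 0 := by
  classical
  simp [constTerm, mono, Finsupp.single_apply]

theorem constTerm_natCast_mul (m : ℕ) (f : XLaurent k n) :
    constTerm ((m : XLaurent k n) * f) = (m : ZLaurent) * constTerm f := by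
  rw [← nsmul_eq_mul, ← nsmul_eq_mul]; exact map_nsmul (constTermₗ k n) m f

/-- The Laurent polynomials whose exponents lie in a given set. -/
noncomputable def spanMono (T : Set (Expo k n)) : Submodule ℤ (XLaurent k n) :=
  Submodule.span ℤ (mono '' T)

theorem mono_mem_spanMono {T : Set (Expo k n)} {e : Expo k n} (h : e ∈ T) :
    mono e ∈ spanMono T := Submodule.subset_span ⟨e, h, rfl⟩

theorem spanMono_le {T : Set (Expo k n)} {N : Submodule ℤ (XLaurent k n)}
    (h : ∀ e ∈ T, mono e ∈ N) : spanMono T ≤ N := by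
  rw [spanMono, Submodule.span_le]
  rintro _ ⟨e, he, rfl⟩
  exact h e he

theorem spanMono_mono {T T' : Set (Expo k n)} (h : T ⊆ T') : spanMono T ≤ spanMono T' :=
  spanMono_le fun _ he => mono_mem_spanMono (h he)

theorem mul_mem_spanMono {T T' U : Set (Expo k n)} (h : ∀ e ∈ T, ∀ f ∈ T', e + f ∈ U)
    {f g : XLaurent k n} (hf : f ∈ spanMono T) (hg : g ∈ spanMono T') : f * g ∈ spanMono U := by
  have := Submodule.mul_mem_mul hf hg
  rw [spanMono, spanMono, Submodule.span_mul_span] at this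
  refine Submodule.span_le.mpr ?_ this
  rintro _ ⟨_, ⟨e, he, rfl⟩, _, ⟨f, hf, rfl⟩, rfl⟩
  change mono e * mono f ∈ spanMono U
  rw [mono_mul]
  exact mono_mem_spanMono (h e he f hf)

theorem frobX_pow_mem_spanMono {T U : Set (Expo k n)} (p t : ℕ) (h : ∀ e ∈ T, p ^ t • e ∈ U)
    {f : XLaurent k n} (hf : f ∈ spanMono T) : (frobX k n p ^ t) f ∈ spanMono U := by
  have : spanMono T ≤ (spanMono U).comap (frobX k n p ^ t).toAddMonoidHom.toIntLinearMap := by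
    refine spanMono_le fun e he => ?_
    change (frobX k n p ^ t) (mono e) ∈ spanMono U
    rw [frobX_pow_mono]
    exact mono_mem_spanMono (h e he)
  exact this hf

/-- The exponents whose `x`-part lies in the cube `[-m, m]`. -/
def cube (k n m : ℕ) : Set (Expo k n) := {e | ∀ c, |e.1 c| ≤ m}

theorem add_mem_cube {l m : ℕ} (e : Expo k n) (he : e ∈ cube k n l) (f : Expo k n)
    (hf : f ∈ cube k n m) : e + f ∈ cube k n (l + m) := fun c =>
  (abs_add_le _ _).trans (by push_cast; exact add_le_add (he c) (hf c))

theorem smul_mem_cube {m : ℕ} (q : ℕ) (e : Expo k n) (he : e ∈ cube k n m) :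
    q • e ∈ cube k n (q * m) := fun c => by
  have := mul_le_mul_of_nonneg_left (he c) (Int.natCast_nonneg q)
  simpa [abs_mul] using this

theorem cube_mono {l m : ℕ} (h : l ≤ m) : cube k n l ⊆ cube k n m := fun _ he c =>
  (he c).trans (by exact_mod_cast h)

/-- Constant terms are multiplicative on `f * σ ^ t g` when the exponents of `f` are less than `p ^ t`. -/
theorem constTerm_mul_frobX_pow {p t m : ℕ} (hm : m < p ^ t) {f : XLaurent k n}
    (hf : f ∈ spanMono (cube k n m)) (g : XLaurent k n) :
    constTerm (f * (frobX k n p ^ t) g) = constTerm f * (frobZ p ^ t) (constTerm g) := by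
  induction hf using Submodule.span_induction with
  | zero => simp [constTerm]
  | add x y _ _ hx hy =>
    rw [add_mul, ← constTermₗ_apply, map_add, constTermₗ_apply, constTermₗ_apply, hx, hy,
      ← constTermₗ_apply (x + y), map_add, add_mul]
    rfl
  | smul a x _ hx =>
    rw [smul_mul_assoc, ← constTermₗ_apply, map_smul, constTermₗ_apply, hx,
      ← constTermₗ_apply (a • x), map_smul, smul_mul_assoc]
    rfl
  | mem x hx =>
    obtain ⟨e, he, rfl⟩ := hx
    induction g using AddMonoidAlgebra.induction_linear with
    | zero => simp [constTerm]
    | add x y hx hy =>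
      rw [map_add, mul_add, ← constTermₗ_apply, map_add, constTermₗ_apply, constTermₗ_apply, hx, hy,
        ← constTermₗ_apply (x + y), map_add, map_add, mul_add]
      rfl
    | single u r =>
      have hfrob : (frobX k n p ^ t) (AddMonoidAlgebra.single u r) =
          AddMonoidAlgebra.single (p ^ t • u) ((frobZ p ^ t) r) := by
        clear he hm
        induction t with
        | zero => simp
        | succ t ih => rw [pow_succ', RingHom.mul_def, RingHom.comp_apply, ih, frobX_single,
            smul_smul, pow_succ' p, pow_succ' (frobZ p), RingHom.mul_def, RingHom.comp_apply]
      rw [hfrob, mono, AddMonoidAlgebra.single_mul_single]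
      classical
      simp only [constTerm, AddMonoidAlgebra.coeff_single, Finsupp.single_apply]
      by_cases hu : u = 0
      · subst hu
        by_cases h0 : e.1 = 0 <;> simp [h0]
      -- A nonzero coordinate of `p ^ t • u` has absolute value at least p^t > m, so `e` cannot
      -- cancel it.
      · obtain ⟨c, hc⟩ := Function.ne_iff.mp hu
        have hne : e.1 + p ^ t • u ≠ 0 := by
          intro h
          have h1 := congrFun h c
          have h2 := he c
          have h3 : e.1 c = -((p ^ t : ℕ) * u c) := by
            have : e.1 c + (p ^ t : ℕ) * u c = 0 := by simpa using h1
            linarith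
          rw [h3, abs_neg, abs_mul, Nat.abs_cast] at h2
          have h4 : (1 : ℤ) ≤ |u c| := Int.one_le_abs hc
          have h5 : ((p ^ t : ℕ) : ℤ) ≤ m := le_trans (by nlinarith [Int.natCast_nonneg (p ^ t)]) h2
          exact absurd (by exact_mod_cast h5) (not_le.mpr hm)
        rw [if_neg hne, if_neg hu]
        simp

/-! ### The superpotential -/

/-- The exponent of `varPow v e`. -/
def vertexExpo (v : Vertex k n) (e : ℤ) : Expo k n :=
  match v with
  | .box c => (Pi.single c e, 0)
  | .z₁ => (0, (e, 0))
  | .z₂ => (0, (0, e))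

theorem varPow_eq_mono (v : Vertex k n) (e : ℤ) : varPow v e = mono (vertexExpo v e) := by
  cases v <;> rfl

open Classical in
theorem superpotential_eq_sum_mono : superpotential k n =
    ∑ e : Vertex k n × Vertex k n with Edge e.1 e.2,
      mono (vertexExpo e.2 1 + vertexExpo e.1 (-1)) := by
  simp [superpotential, varPow_eq_mono, mono_mul]

/-- A set which contains the exponents of the `d`-th power of the superpotential: it is
homogeneous with respect to two gradings. -/
def powExpo (k n d : ℕ) : Set (Expo k n) :=
  {e | e ∈ cube k n d ∧ 0 ≤ e.2.1 ∧ ∑ c, e.1 c + e.2.1 + e.2.2 = 0 ∧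
    ∑ c : Box k n, (weight c : ℤ) * e.1 c + n * e.2.2 = -d}

theorem add_mem_powExpo {d d' : ℕ} (e : Expo k n) (he : e ∈ powExpo k n d) (f : Expo k n)
    (hf : f ∈ powExpo k n d') : e + f ∈ powExpo k n (d + d') := by
  obtain ⟨h1, h2, h3, h4⟩ := he
  obtain ⟨h1', h2', h3', h4'⟩ := hf
  refine ⟨add_mem_cube e h1 f h1', add_nonneg h2 h2', ?_, ?_⟩
  · simp only [Prod.fst_add, Prod.snd_add, Pi.add_apply, Finset.sum_add_distrib]
    linarith
  · simp only [Prod.fst_add, Prod.snd_add, Pi.add_apply, mul_add, Finset.sum_add_distrib]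
    push_cast
    linarith

/-- The gradings are total degree, preserved by every edge, and the weight, lowered by one along
every edge once z₁ gets weight 0 and z₂ weight n. -/
theorem edge_mem_powExpo {t h : Vertex k n} (he : Edge t h) :
    vertexExpo h 1 + vertexExpo t (-1) ∈ powExpo k n 1 := by
  cases he with
  | boxes c c' hadj hw =>
    have : weight c = weight c' + 1 := by
      unfold weight BoxAdj at *
      rcases hadj with ⟨h1, h2⟩ | ⟨h1, h2⟩ <;> have := congrArg Fin.val h1 <;> omega
    refine ⟨fun b => ?_, ?_, ?_, ?_⟩
    · simp only [vertexExpo, Prod.fst_add, Pi.add_apply, Pi.single_apply]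
      split_ifs <;> simp
    · simp [vertexExpo]
    · simp [vertexExpo, Finset.sum_add_distrib]
    · simp [vertexExpo, mul_add, Finset.sum_add_distrib, Pi.single_apply, this]
  | bottom c h₁ h₂ =>
    have : weight c = 1 := by unfold weight; omega
    refine ⟨fun b => ?_, ?_, ?_, ?_⟩
    · simp only [vertexExpo, Prod.fst_add, Pi.add_apply, Pi.single_apply]
      split_ifs <;> simp
    · simp [vertexExpo]
    · simp [vertexExpo]
    · simp [vertexExpo, Pi.single_apply, this]
  | top c h₁ h₂ =>
    have h3 := c.2.isLt
    have : n = weight c + 1 := by unfold weight; omega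
    have hn : (n : ℤ) = weight c + 1 := by exact_mod_cast this
    refine ⟨fun b => ?_, ?_, ?_, ?_⟩
    · simp only [vertexExpo, Prod.fst_add, Pi.add_apply, Pi.single_apply]
      split_ifs <;> simp
    · simp [vertexExpo]
    · simp [vertexExpo]
    · simp [vertexExpo, Pi.single_apply, hn]

theorem superpotential_pow_mem (d : ℕ) :
    superpotential k n ^ d ∈ spanMono (powExpo k n d) := by
  induction d with
  | zero =>
    rw [pow_zero, ← mono_zero]
    exact mono_mem_spanMono ⟨fun c => by simp, by simp, by simp, by simp⟩
  | succ d ih =>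
    rw [pow_succ]
    refine mul_mem_spanMono (T' := powExpo k n 1) add_mem_powExpo ih ?_
    rw [superpotential_eq_sum_mono]
    refine Submodule.sum_mem _ fun e he => mono_mem_spanMono (edge_mem_powExpo ?_)
    simpa using he

theorem sum_superpotential_pow_mem {N : ℕ} (hN : 0 < N) :
    ∑ d ∈ Finset.range N, superpotential k n ^ d ∈ spanMono (cube k n (N - 1)) :=
  Submodule.sum_mem _ fun d hd => spanMono_mono
    (Set.Subset.trans (fun _ he => he.1)
      (cube_mono (l := d) (by have := Finset.mem_range.mp hd; omega))) (superpotential_pow_mem d)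

theorem dvd_superpotential_pow_sub {p : ℕ} (hp : p.Prime) :
    (p : XLaurent k n) ∣ superpotential k n ^ p - frobX k n p (superpotential k n) := by
  classical
  rw [superpotential_eq_sum_mono]
  exact dvd_sum_pow_sub_map _ hp _ _ fun e _ => by rw [frobX_mono, mono_pow]

/-- The bound reproduces itself under the recursion: (p^u - 1) + p^u (p^(t+1-u) - 1) = p^(t+1) - 1.
-/
theorem skewInv_mem_cube {p : ℕ} (hp : 0 < p) (t : ℕ) :
    skewInv (frobX k n p) (fun s => ∑ d ∈ Finset.range (p ^ s), superpotential k n ^ d) t ∈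
      spanMono (cube k n (p ^ t - 1)) := by
  induction t using Nat.strong_induction_on with
  | _ t ih =>
  cases t with
  | zero =>
    rw [skewInv_zero, ← mono_zero]
    exact mono_mem_spanMono fun c => by simp
  | succ t =>
    rw [skewInv_succ]
    refine Submodule.neg_mem _ (Submodule.sum_mem _ fun u hu => ?_)
    have hu : u < t + 1 := by simpa using hu
    refine mul_mem_spanMono (fun e he f hf => ?_) (ih u hu)
      (frobX_pow_mem_spanMono p u (smul_mem_cube (p ^ u))
        (sum_superpotential_pow_mem (N := p ^ (t + 1 - u)) (by positivity)))
    convert add_mem_cube e he f hf using 2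
    have h1 : 0 < p ^ u := by positivity
    have h2 : p ^ (t + 1) = p ^ u * p ^ (t + 1 - u) := by rw [← pow_add]; congr 1; omega
    have h3 : p ^ u ≤ p ^ u * p ^ (t + 1 - u) := Nat.le_mul_of_pos_right _ (by positivity)
    rw [h2, Nat.mul_sub, mul_one]
    omega

/-- The congruences for the constant terms, in the ring of Laurent polynomials in `z₁, z₂`. -/
theorem constTerm_congruence {p : ℕ} (hp : p.Prime) {a b : ℕ} (hba : b ≤ a) :
    (p : ZLaurent) ^ (b + 1) ∣
      constTerm (∑ d ∈ Finset.range (p ^ (a + 1)), superpotential k n ^ d) *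
        frobZ p (constTerm (∑ d ∈ Finset.range (p ^ b), superpotential k n ^ d)) -
      constTerm (∑ d ∈ Finset.range (p ^ (b + 1)), superpotential k n ^ d) *
        frobZ p (constTerm (∑ d ∈ Finset.range (p ^ a), superpotential k n ^ d)) := by
  set P : ℕ → XLaurent k n := fun s => ∑ d ∈ Finset.range (p ^ s), superpotential k n ^ d with hP
  have hP0 : P 0 = 1 := by simp [hP]
  have := dwork_congruence (frobZ p) p (fun s => constTerm (P s))
    (fun t => constTerm (skewInv (frobX k n p) P t)) ?_ ?_ ?_ 1 a b one_pos hba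
  · simpa only [pow_one, add_comm 1] using this
  · simp only [skewInv_zero]
    exact (constTerm_mono (0 : Expo k n)).trans (by simp [AddMonoidAlgebra.one_def])
  · intro t
    have h := pow_dvd_skewInv_prod (frobX k n p) p
      (fun i => ∑ j ∈ Finset.range p, (superpotential k n ^ p ^ i) ^ j)
      (pow_dvd_geom_sum_sub _ (dvd_superpotential_pow_sub hp)) t
    simp only [prod_geom_sum] at h
    obtain ⟨q, hq⟩ := h
    refine ⟨constTerm q, ?_⟩
    rw [hP, hq, ← Nat.cast_pow, constTerm_natCast_mul, Nat.cast_pow]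
  · intro t
    have h := congrArg (constTermₗ k n) (sum_skewInv_mul (frobX k n p) hP0 t)
    rw [map_sum, map_zero] at h
    rw [← h]
    refine Finset.sum_congr rfl fun u _ => ?_
    rw [constTermₗ_apply, constTerm_mul_frobX_pow _ (skewInv_mem_cube hp.pos u)]
    have : 0 < p ^ u := pow_pos hp.pos u
    omega

end GrassmannSuperpotential

/-! ### Descent from Laurent polynomials in z₁, z₂ to polynomials and power series in z. -/

namespace GrassmannSuperpotential

variable {k n : ℕ}

theorem coeff_readZ (f : ZLaurent) (m : ℕ) : (readZ f).coeff m = f.coeff ((m : ℤ), -(m : ℤ)) := rfl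

/-- `readZ` as a linear map. -/
noncomputable def readZₗ : ZLaurent →ₗ[ℤ] ℤ[X] :=
  AddMonoidHom.toIntLinearMap
    { toFun := readZ, map_zero' := by ext; simp [coeff_readZ],
      map_add' := fun f g => by ext; simp [coeff_readZ] }

theorem readZₗ_apply (f : ZLaurent) : readZₗ f = readZ f := rfl

theorem zRatio_pow (m : ℕ) : zRatio ^ m = AddMonoidAlgebra.single ((m : ℤ), -(m : ℤ)) 1 := by
  simp [zRatio, AddMonoidAlgebra.single_pow]

theorem readZ_zRatio_pow (m : ℕ) : readZ (zRatio ^ m) = Polynomial.X ^ m := by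
  classical
  ext j
  simp [coeff_readZ, zRatio_pow, Polynomial.coeff_X_pow, Finsupp.single_apply, eq_comm]

theorem readZ_aeval (Q : ℤ[X]) : readZ (Polynomial.aeval zRatio Q) = Q := by
  rw [Polynomial.aeval_eq_sum_range, ← readZₗ_apply, map_sum]
  simp only [map_smul, readZₗ_apply, readZ_zRatio_pow, ← Polynomial.C_mul',
    ← Polynomial.as_sum_range_C_mul_X_pow]

theorem frobZ_aeval (p : ℕ) (Q : ℤ[X]) :
    frobZ p (Polynomial.aeval zRatio Q) = Polynomial.aeval zRatio (Polynomial.expand ℤ p Q) := by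
  rw [Polynomial.expand_aeval]
  have h : frobZ p zRatio = zRatio ^ p := by rw [zRatio_pow, zRatio, frobZ_single]; simp
  rw [← h]
  exact (Polynomial.aeval_algHom_apply (frobZ p).toIntAlgHom zRatio Q).symm

/-- Without box variables, the gradings of z₁^a z₂^b read a + b = 0 and n b = -d, so d = n a; the
condition a ≥ 0 excludes negative powers of z. -/
theorem constTerm_mono_of_mem_powExpo {d : ℕ} {e : Expo k n} (he : e ∈ powExpo k n d) :
    constTerm (mono e) = 0 ∨ ∃ m : ℕ, d = n * m ∧ constTerm (mono e) = zRatio ^ m := by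
  obtain ⟨u, a, b⟩ := e
  obtain ⟨-, ha, h1, h2⟩ := he
  rw [constTerm_mono]
  split_ifs with hu
  · right
    lift a to ℕ using ha
    change u = 0 at hu
    subst hu
    obtain rfl : b = -a := by simp at h1; linarith
    refine ⟨a, ?_, by rw [zRatio_pow]⟩
    have : (d : ℤ) = n * a := by simp at h2; linarith
    exact_mod_cast this
  · exact .inl rfl

theorem constTerm_superpotential_pow (d : ℕ) :
    constTerm (superpotential k n ^ d) = Polynomial.aeval zRatio (ctS k n d) := by
  have h : spanMono (powExpo k n d) ≤ LinearMap.eqLocus (constTermₗ k n)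
      ((Polynomial.aeval zRatio).toLinearMap ∘ₗ readZₗ ∘ₗ constTermₗ k n) := by
    refine spanMono_le fun e he => ?_
    change constTerm (mono e) = Polynomial.aeval zRatio (readZ (constTerm (mono e)))
    obtain h | ⟨m, -, h⟩ := constTerm_mono_of_mem_powExpo he
    · rw [h, ← readZₗ_apply, map_zero, map_zero]
    · simp [h, readZ_zRatio_pow]
  exact h (superpotential_pow_mem d)

theorem coeff_ctS_eq_zero {d m : ℕ} (hd : d ≠ n * m) : (ctS k n d).coeff m = 0 := by
  have h : spanMono (powExpo k n d) ≤
      LinearMap.ker (Polynomial.lcoeff ℤ m ∘ₗ readZₗ ∘ₗ constTermₗ k n) := by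
    refine spanMono_le fun e he => ?_
    change (readZ (constTerm (mono e))).coeff m = 0
    obtain h | ⟨j, hj, h⟩ := constTerm_mono_of_mem_powExpo he
    · rw [h, ← readZₗ_apply, map_zero, Polynomial.coeff_zero]
    · rw [h, readZ_zRatio_pow, Polynomial.coeff_X_pow, if_neg]
      rintro rfl
      exact hd hj
  exact h (superpotential_pow_mem d)

theorem ctS_zero (k n : ℕ) : ctS k n 0 = 1 := by
  have : constTerm (superpotential k n ^ 0) = zRatio ^ 0 := by
    rw [pow_zero, pow_zero, ← mono_zero, constTerm_mono]
    exact if_pos rfl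
  rw [ctS, this, readZ_zRatio_pow, pow_zero]

theorem coeff_seriesF (m : ℕ) : (seriesF k n).coeff m = (ctS k n (n * m)).coeff m := by
  rw [seriesF, PowerSeries.coeff_mk]
  exact finsum_eq_single _ _ fun d hd => coeff_ctS_eq_zero hd

theorem coeff_truncF (p s m : ℕ) :
    (truncF k n p s).coeff m = if n * m < p ^ s then (ctS k n (n * m)).coeff m else 0 := by
  rw [truncF, Polynomial.finsetSum_coeff]
  split_ifs with h
  · exact Finset.sum_eq_single_of_mem _ (Finset.mem_range.mpr h) fun d _ hd => coeff_ctS_eq_zero hd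
  · exact Finset.sum_eq_zero fun d hd => coeff_ctS_eq_zero fun h' =>
      h (h' ▸ Finset.mem_range.mp hd)

theorem constantCoeff_seriesF : PowerSeries.constantCoeff (seriesF k n) = 1 := by
  rw [← PowerSeries.coeff_zero_eq_constantCoeff_apply, coeff_seriesF, mul_zero, ctS_zero]
  simp

theorem coeff_zero_truncF {p : ℕ} (hp : 0 < p) (s : ℕ) : (truncF k n p s).coeff 0 = 1 := by
  rw [coeff_truncF, mul_zero, if_pos (pow_pos hp s), ctS_zero]
  simp

theorem aeval_truncF (p s : ℕ) : Polynomial.aeval zRatio (truncF k n p s) =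
    constTerm (∑ d ∈ Finset.range (p ^ s), superpotential k n ^ d) := by
  rw [truncF, map_sum, ← constTermₗ_apply, map_sum]
  exact Finset.sum_congr rfl fun d _ => (constTerm_superpotential_pow d).symm

/-- The congruences for the truncations, with denominators cleared. -/
theorem truncF_congruence {p : ℕ} (hp : p.Prime) {a b : ℕ} (hba : b ≤ a) :
    (p : ℤ[X]) ^ (b + 1) ∣
      truncF k n p (a + 1) * Polynomial.expand ℤ p (truncF k n p b) -
      truncF k n p (b + 1) * Polynomial.expand ℤ p (truncF k n p a) := by
  obtain ⟨q, hq⟩ := constTerm_congruence (k := k) (n := n) hp hba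
  simp only [← aeval_truncF, frobZ_aeval, ← map_mul, ← map_sub] at hq
  refine ⟨readZ q, ?_⟩
  -- The quotient `q` need not be a polynomial in z, and `readZ` is only additive; it still commutes
  -- with multiplication by the integer p^(b+1).
  rw [← readZ_aeval (_ - _), hq, ← Nat.cast_pow, ← Nat.cast_pow, ← nsmul_eq_mul, ← nsmul_eq_mul]
  exact map_nsmul readZₗ _ q

/-! ### Congruences between quotients of power series. -/

theorem congMod_iff {N : ℤ} {f g : ℤ⟦X⟧} : CongMod N f g ↔ PowerSeries.C N ∣ f - g := by
  constructor
  · intro h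
    choose q hq using fun m => (h m).symm.dvd
    refine ⟨.mk q, ?_⟩
    ext m
    rw [map_sub, hq, PowerSeries.coeff_C_mul, PowerSeries.coeff_mk]
  · rintro ⟨q, hq⟩ m
    refine (Int.modEq_iff_dvd.mpr ⟨q.coeff m, ?_⟩).symm
    rw [← map_sub, hq, PowerSeries.coeff_C_mul]

/-- Quotients are congruent when the cross products are. -/
theorem congMod_quot {N : ℤ} {f g f' g' : ℤ⟦X⟧} (hg : PowerSeries.constantCoeff g = 1)
    (hg' : PowerSeries.constantCoeff g' = 1) (h : CongMod N (f * g') (f' * g)) :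
    CongMod N (quot f g) (quot f' g') := by
  rw [congMod_iff] at h ⊢
  have h1 := PowerSeries.mul_invOfUnit g 1 hg
  have h2 := PowerSeries.mul_invOfUnit g' 1 hg'
  refine (Dvd.dvd.mul_right h (PowerSeries.invOfUnit g 1 * PowerSeries.invOfUnit g' 1)).trans
    (dvd_of_eq ?_)
  rw [quot, quot]
  linear_combination f * PowerSeries.invOfUnit g 1 * h2 - f' * PowerSeries.invOfUnit g' 1 * h1

theorem congMod_of_dvd {p s : ℕ} {f g : ℤ[X]} (h : (p : ℤ[X]) ^ s ∣ f - g) :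
    CongMod ((p : ℤ) ^ s) (f : ℤ⟦X⟧) (g : ℤ⟦X⟧) := by
  obtain ⟨q, hq⟩ := h
  refine congMod_iff.mpr ⟨q, ?_⟩
  have hC : (PowerSeries.C ((p : ℤ) ^ s)) = ((p : ℤ[X]) ^ s : ℤ[X]) := by
    rw [Polynomial.coe_pow, map_pow, map_natCast]
    exact congrArg (· ^ s) (map_natCast Polynomial.coeToPowerSeries.ringHom p).symm
  rw [← Polynomial.coe_sub, hq, Polynomial.coe_mul, hC]

theorem constantCoeff_expand_truncF {p : ℕ} (hp : p.Prime) (s : ℕ) :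
    PowerSeries.constantCoeff (Polynomial.expand ℤ p (truncF k n p s) : ℤ⟦X⟧) = 1 := by
  rw [← PowerSeries.coeff_zero_eq_constantCoeff_apply, Polynomial.coeff_coe,
    Polynomial.coeff_expand hp.pos, if_pos (dvd_zero p), Nat.zero_div, coeff_zero_truncF hp.pos]

theorem coeff_truncF_eq_coeff_seriesF {p s m : ℕ} (h : n * m < p ^ s) :
    (truncF k n p s : ℤ⟦X⟧).coeff m = (seriesF k n).coeff m := by
  rw [Polynomial.coeff_coe, coeff_truncF, if_pos h, coeff_seriesF]

theorem coeff_expand_truncF_eq {p s m : ℕ} (hp : p.Prime) (h : n * m < p ^ s) :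
    (Polynomial.expand ℤ p (truncF k n p s) : ℤ⟦X⟧).coeff m =
      ((seriesF k n).expand p hp.ne_zero).coeff m := by
  rw [Polynomial.coeff_coe, Polynomial.coeff_expand hp.pos, PowerSeries.coeff_expand]
  split_ifs with hm
  · rw [← Polynomial.coeff_coe, coeff_truncF_eq_coeff_seriesF]
    exact lt_of_le_of_lt (Nat.mul_le_mul_left n (Nat.div_le_self m p)) h
  · rfl

theorem seriesF_congruence {p : ℕ} (hp : p.Prime) (b : ℕ) :
    CongMod ((p : ℤ) ^ (b + 1))
      (seriesF k n * (Polynomial.expand ℤ p (truncF k n p b) : ℤ[X]))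
      (truncF k n p (b + 1) * (seriesF k n).expand p hp.ne_zero) := by
  intro m
  -- The limit a → ∞: the coefficient of z^i in F comes from d = n i alone, so for this `a` the
  -- truncations of levels `a` and `a + 1` agree with F up to degree `m`.
  obtain ⟨a, ha, hba⟩ : ∃ a, n * m < p ^ a ∧ b ≤ a :=
    ⟨n * m + b, (Nat.lt_pow_self hp.one_lt).trans_le
      (Nat.pow_le_pow_right hp.pos (Nat.le_add_right _ _)), Nat.le_add_left _ _⟩
  have h := congMod_of_dvd (truncF_congruence (k := k) (n := n) hp hba) m
  rw [Polynomial.coe_mul, Polynomial.coe_mul, PowerSeries.coeff_mul, PowerSeries.coeff_mul] at h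
  rw [PowerSeries.coeff_mul, PowerSeries.coeff_mul]
  have hlt {i : ℕ} (hi : i ≤ m) : n * i < p ^ a := lt_of_le_of_lt (Nat.mul_le_mul_left n hi) ha
  convert h using 1
  · refine Finset.sum_congr rfl fun x hx => ?_
    rw [coeff_truncF_eq_coeff_seriesF
      ((hlt (Finset.HasAntidiagonal.antidiagonal.fst_le hx)).trans_le (Nat.pow_le_pow_right hp.pos a.le_succ))]
  · refine Finset.sum_congr rfl fun x hx => ?_
    rw [coeff_expand_truncF_eq hp (hlt (Finset.HasAntidiagonal.antidiagonal.snd_le hx))]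

end GrassmannSuperpotential

open GrassmannSuperpotential in
theorem theorem5p1 (k n p : ℕ) (hk : 0 < k) (hkn : k < n) (hp : p.Prime) :
    -- `[S ^ d]₀` is a polynomial in `z = z₁ / z₂`, and `∑ d, [S ^ d]₀` is a well-defined element
    -- of `ℤ⟦z⟧`; all the denominators below have constant term `1`
    (∀ d : ℕ, constTerm (superpotential k n ^ d) = Polynomial.aeval zRatio (ctS k n d)) ∧
    (∀ m : ℕ, {d : ℕ | (ctS k n d).coeff m ≠ 0}.Finite) ∧
    PowerSeries.constantCoeff (seriesF k n) = 1 ∧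
    (∀ s : ℕ, (truncF k n p s).coeff 0 = 1) ∧
    -- the congruences
    (∀ s : ℕ, 1 ≤ s →
      CongMod ((p : ℤ) ^ s)
        (quot (seriesF k n) ((seriesF k n).expand p hp.ne_zero))
        (quot (truncF k n p s) (Polynomial.expand ℤ p (truncF k n p (s - 1)) : ℤ[X]))) ∧
    (∀ s : ℕ, 1 ≤ s →
      CongMod ((p : ℤ) ^ s)
        (quot (truncF k n p (s + 1)) (Polynomial.expand ℤ p (truncF k n p s) : ℤ[X]))
        (quot (truncF k n p s) (Polynomial.expand ℤ p (truncF k n p (s - 1)) : ℤ[X]))) := by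
  have expand_seriesF : PowerSeries.constantCoeff ((seriesF k n).expand p hp.ne_zero) = 1 := by
    rw [PowerSeries.constantCoeff_expand, constantCoeff_seriesF]
  refine ⟨constTerm_superpotential_pow, fun m => ?_, constantCoeff_seriesF,
    coeff_zero_truncF hp.pos, fun s hs => ?_, fun s hs => ?_⟩
  · refine (Set.finite_singleton (n * m)).subset fun d hd => ?_
    by_contra h
    exact hd (coeff_ctS_eq_zero h)
  · obtain ⟨b, rfl⟩ := Nat.exists_eq_add_of_le' hs
    exact congMod_quot expand_seriesF (constantCoeff_expand_truncF hp b) (seriesF_congruence hp b)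
  · obtain ⟨b, rfl⟩ := Nat.exists_eq_add_of_le' hs
    refine congMod_quot (constantCoeff_expand_truncF hp _) (constantCoeff_expand_truncF hp b) ?_
    rw [← Polynomial.coe_mul, ← Polynomial.coe_mul]
    exact congMod_of_dvd (truncF_congruence hp b.le_succ)
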